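/- **The language of £.** Terms and formulas are generated simultaneously. The constants $\mathrm T$ (alethizor) and € (enumerator) and the noemata $v_0,v_1,\dots$ are terms; if $a,b$ are terms and $A,B$ are formulas, then ${\downarrow}ab$ and $\{v_n\mid A\}$ are terms, and $a\in b$ (officially written $ba$), ${\downarrow}AB$ ("neither $A$ nor $B$") and $\forall v_nA$ are formulas. The noemata *present* in an expression are those that occur in it and are not bound by $\forall v_n$ or $\{v_n\mid\cdot\}$; a term (formula) with no noema present is a *cognomen* (*proposition*). $A(a/u)$ is the result of substituting $a$ for $u$ where $u$ is present in $A$. The connectives and $\exists$ are defined from $\downarrow$ and $\forall$ as usual; $a=b$ is $\forall u(a\in u\to b\in u)$ and $\mathbb TA$ is $\exists y(y\in\{y\mid A\})$, with $u,y$ the least noemata not present in $a,b$ and in $A$, respectively; $a\neq b$ is $\neg\, a=b$; $\langle a,b\rangle$ is the Kuratowski pair formed with $\{x\mid x=a\vee x=b\}$; and $\emptyset=\{y\mid y\ne y\}$. Numerals are the cognomina $\ulcorner 0\urcorner=\{v_0\mid v_0\neq v_0\}$ and $\ulcorner n+1\urcorner=\{v_0\mid v_0\in\ulcorner n\urcorner\vee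 v_0=\ulcorner n\urcorner\}$. In Polish notation, with the symbols $|_0$ for $\{\cdot\mid\cdot\}$, $|_1$ for $\forall$, $|_2$ for $\downarrow$, $|_3$ for $\mathrm T$, $|_4$ for € and $|_{n+5}$ for $v_n$, an expression is identified with the number whose binary numeral is obtained by writing $1$ followed by $k$ zeros for each symbol $|_k$; $\ulcorner A\urcorner$ is the numeral of the number of $A$. **Enumeration of cognomina.** Alphabetological variance is the least pair of relations, on propositions and on cognomina, such that: propositions $A,B$ are variants if $A\leftrightarrow B$ is provable in classical first-order logic, or if $A$ is a variant of the result of replacing a cognomen $b$ everywhere in $B$ by a variant $a$ of it; $\mathrm T$ is a variant of $\mathrm T$ and € of €; ${\downarrow}cd$ is a variant of ${\downarrow}ef$ if $c,d$ are variants of $e,f$, or of $f,e$, respectively; $\{x\mid A\}$ is a variant of $\{y\mid B\}$ if $\exists xA$ is a variant of $\exists yB$. By recursion on $n$, let $c_n$ be the cognomen with the smallest number among those not paired with any $m<n$, where $n$ is paired with the cognomina of which $c_n$ is a variant. **Semantics.** By recursion on ordinals, $\alpha\vDash A$ is defined so that for all terms, formulas, noemata and numbers: 1. for cognomina $a$ and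 $\{u\mid A\}$: $\alpha\vDash a\in\{u\mid A\}$ iff there is $\beta<\alpha$ with $\gamma\vDash A(a/u)$ whenever $\beta\le\gamma<\alpha$; 2. $\alpha\vDash{\downarrow}AB$ iff $\alpha\nvDash A$ and $\alpha\nvDash B$; 3. $\alpha\vDash a\in{\downarrow}bc$ iff $\alpha\nvDash a\in b$ and $\alpha\nvDash a\in c$; 4. $\alpha\vDash\forall yA$ iff $\alpha\vDash A(a/y)$ for all cognomina $a$; 5. $\alpha\vDash u\in\mathrm T$ iff $\alpha\vDash u=\ulcorner A\urcorner\wedge\mathbb TA$ for some formula $A$; 6. each noema names a cognomen at $\alpha$: $v_n$ names $c_n$ if $\alpha\vDash v_m\ne c_n$ for all $m<n$, and otherwise it names what $v_{n-1}$ names; $\alpha\vDash A$ iff $\alpha\vDash A'$, where $A'$ arises from $A$ by replacing the noemata present in $A$ by the cognomina that they name at $\alpha$; 7. $\alpha\vDash u\in$ € iff $\alpha\vDash u=\langle\ulcorner n\urcorner,a\rangle\wedge a=v_n$ for some term $a$ and number $n$. The identities in 5–7 hold between two cognomina at $\alpha$ iff these are members at $\alpha$ of the same cognomina of the form $\{u\mid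 A\}$; membership in all other cognomina then respects this relation, so that it agrees with $a=b$ as defined above. Let $\vDash_\gamma$ be the set of formulas $A$ with $\gamma\vDash\mathbb TA$; let $IN$ and $OUT$ be the sets of formulas that belong, respectively do not belong, to $\vDash_\gamma$ for all sufficiently large ordinals $\gamma$, and let $UNSTAB$ be the set of all other formulas. A limit ordinal $\sigma$ *stabilizes* $\vDash$ if $IN\subseteq{\vDash_\gamma}\subseteq IN\cup UNSTAB$ for all $\gamma\ge\sigma$, and ${\vDash_\sigma}\subseteq IN$. Let $\kappa$ be the least stabilizing ordinal. A formula $A$ is a *maxim* of £ if $\kappa\vDash\mathbb TA$. **Theorem.** For every term $a$ of £ and every noema $x$ not present in $a$, $$a=\{x\mid x\in a\}\ \text{ is a maxim of £}\quad\Longleftrightarrow\quad a=\emptyset\ \text{ is a maxim of £},$$ where $\emptyset=\{y\mid y\neq y\}$ for an arbitrary noema $y$. -/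

import Mathlib

namespace Librationism

/-! ## Language

Symbols are `|_n` (a bar followed by `n` dots): `|_0` sortifier, `|_1` universalizor,
`|_2` norifyer, `|_3` alethizor `T`, `|_4` enumerator `€`, and `|_(n+5)` the noema `v_n`. -/

mutual
/-- Terms (nomina): the alethizor, the enumerator, the noemata `v_n`, the junctures `↓ab`,
and the sorts `{v_n | A}`. -/
inductive Term : Type
  | alethizor : Term
  | enumerator : Term
  | noema (n : ℕ) : Term
  | joint (a b : Term) : Term
  | sort (n : ℕ) (A : Formula) : Term
/-- Formulas (sentences): the atomic formulas `ba`, read `a ∈ b`, then `↓AB` (neither `A`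
nor `B`), and `∀ v_n A`. -/
inductive Formula : Type
  | app (b a : Term) : Formula
  | nor (A B : Formula) : Formula
  | all (n : ℕ) (A : Formula) : Formula
end

mutual
/-- The (indices of the) noemata present in a term. -/
def Term.noemata : Term → Finset ℕ
  | .alethizor => ∅
  | .enumerator => ∅
  | .noema n => {n}
  | .joint a b => a.noemata ∪ b.noemata
  | .sort n A => A.noemata.erase n
/-- The (indices of the) noemata present in a formula. -/
def Formula.noemata : Formula → Finset ℕ
  | .app b a => b.noemata ∪ a.noemata
  | .nor A B => A.noemata ∪ B.noemata
  | .all n A => A.noemata.erase n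
end

/-- A cognomen is a term in which no noema is present. -/
def Term.IsCognomen (a : Term) : Prop := a.noemata = ∅

/-- A proposition is a formula in which no noema is present. -/
def Formula.IsProposition (A : Formula) : Prop := A.noemata = ∅

mutual
/-- Simultaneous substitution of `ρ n` for every present noema `v_n`, in a term. -/
def Term.inst (ρ : ℕ → Term) : Term → Term
  | .alethizor => .alethizor
  | .enumerator => .enumerator
  | .noema n => ρ n
  | .joint a b => .joint (a.inst ρ) (b.inst ρ)
  | .sort n A => .sort n (A.inst (Function.update ρ n (.noema n)))
/-- Simultaneous substitution of `ρ n` for every present noema `v_n`, in a formula. -/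
def Formula.inst (ρ : ℕ → Term) : Formula → Formula
  | .app b a => .app (b.inst ρ) (a.inst ρ)
  | .nor A B => .nor (A.inst ρ) (B.inst ρ)
  | .all n A => .all n (A.inst (Function.update ρ n (.noema n)))
end

/-- `A(a/u)`: substitution of the term `a` for the noema `v_u` in `A`. -/
def Formula.subst (a : Term) (u : ℕ) (A : Formula) : Formula :=
  A.inst (Function.update Term.noema u a)

mutual
/-- The term `a` is substitutable for the noema `v_u` in a term. -/
def Term.Substitutable (a : Term) (u : ℕ) : Term → Prop
  | .alethizor => True
  | .enumerator => True
  | .noema _ => True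
  | .joint b c => Term.Substitutable a u b ∧ Term.Substitutable a u c
  | .sort n A => (n ∉ a.noemata ∨ u ∉ A.noemata) ∧ A.Substitutable a u
/-- The term `a` is substitutable for the noema `v_u` in a formula. -/
def Formula.Substitutable (a : Term) (u : ℕ) : Formula → Prop
  | .app c b => Term.Substitutable a u c ∧ Term.Substitutable a u b
  | .nor A B => A.Substitutable a u ∧ B.Substitutable a u
  | .all n A => (n ∉ a.noemata ∨ u ∉ A.noemata) ∧ A.Substitutable a u
end

/-! ## Defined notions of the object language -/

/-- `a ∈ b`. -/
def mem (a b : Term) : Formula := .app b a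

def neg (A : Formula) : Formula := .nor A A

def disj (A B : Formula) : Formula := .nor (.nor A B) (.nor A B)

def conj (A B : Formula) : Formula := .nor (.nor A A) (.nor B B)

def imp (A B : Formula) : Formula := .nor (.nor (.nor A A) B) (.nor (.nor A A) B)

def biimp (A B : Formula) : Formula := conj (imp A B) (imp B A)

def ex (n : ℕ) (A : Formula) : Formula := neg (.all n (neg A))

/-- The index of the least noema outside a finite set of noemata. -/
noncomputable def fresh (s : Finset ℕ) : ℕ := sInf {n | n ∉ s}

/-- Leibnizian identity `a = b`, that is `∀ u (a ∈ u → b ∈ u)`. -/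
noncomputable def eq (a b : Term) : Formula :=
  let u := fresh (a.noemata ∪ b.noemata)
  .all u (imp (mem a (.noema u)) (mem b (.noema u)))

/-- The truth operator: `∃ y (y ∈ {y | A})` for the least noema `y` not present in `A`. -/
noncomputable def truth (A : Formula) : Formula :=
  let y := fresh A.noemata
  ex y (mem (.noema y) (.sort y A))

/-- The sort `∅ = {y | y ≠ y}`, for `y` the noema with index `y`. -/
noncomputable def emptySort (y : ℕ) : Term := .sort y (neg (eq (.noema y) (.noema y)))

/-- The unordered pair `{x | x = a ∨ x = b}`. -/
noncomputable def upair (a b : Term) : Term :=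
  let x := fresh (a.noemata ∪ b.noemata)
  .sort x (disj (eq (.noema x) a) (eq (.noema x) b))

/-- The Kuratowski ordered pair. -/
noncomputable def opair (a b : Term) : Term := upair (upair a a) (upair a b)

/-! ## Expressions as numbers, and numerals -/

/-- Concatenation of binary numerals: `m * 2 ^ l(n) + n`, with `l(n)` the binary length. -/
def cat (m n : ℕ) : ℕ := m * 2 ^ n.size + n

mutual
/-- The number that a term is: the symbol `|_n` is `2 ^ n`, in Polish notation. -/
def Term.num : Term → ℕ
  | .alethizor => 2 ^ 3
  | .enumerator => 2 ^ 4
  | .noema n => 2 ^ (n + 5)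
  | .joint a b => cat (2 ^ 2) (cat a.num b.num)
  | .sort n A => cat (2 ^ 0) (cat (2 ^ (n + 5)) A.num)
/-- The number that a formula is. -/
def Formula.num : Formula → ℕ
  | .app b a => cat b.num a.num
  | .nor A B => cat (2 ^ 2) (cat A.num B.num)
  | .all n A => cat (2 ^ 1) (cat (2 ^ (n + 5)) A.num)
end

/-- The term `⌜n⌝` of the object language that denotes `n`:
`⌜0⌝ = {v₀ | v₀ ≠ v₀}` and `⌜n+1⌝ = {v₀ | v₀ ∈ ⌜n⌝ ∨ v₀ = ⌜n⌝}`. -/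
noncomputable def numeral : ℕ → Term
  | 0 => .sort 0 (neg (eq (.noema 0) (.noema 0)))
  | n + 1 => .sort 0 (disj (mem (.noema 0) (numeral n)) (eq (.noema 0) (numeral n)))

/-! ## Classical provability, alphabetological variants and their enumeration -/

/-- Propositional tautologies over `nor`. -/
def Tautology (A : Formula) : Prop :=
  ∀ v : Formula → Prop, (∀ B C, v (.nor B C) ↔ ¬ v B ∧ ¬ v C) → v A

/-- Provability in classical first-order logic (without identity) in this language. -/
inductive Provable : Formula → Prop
  | taut {A : Formula} : Tautology A → Provable A
  | vacuous {A : Formula} {x : ℕ} : x ∉ A.noemata → Provable (imp A (.all x A))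
  | dist {A B : Formula} {x : ℕ} :
      Provable (imp (.all x (imp A B)) (imp (.all x A) (.all x B)))
  | spec {A : Formula} {x : ℕ} {a : Term} :
      A.Substitutable a x → Provable (imp (.all x A) (A.subst a x))
  | mp {A B : Formula} : Provable A → Provable (imp A B) → Provable B
  | gen {A : Formula} {x : ℕ} : Provable A → Provable (.all x A)

open Classical in
mutual
/-- Replacement of every occurrence of the cognomen `b` by `a`, in a term. -/
noncomputable def Term.replace (b a : Term) : Term → Term
  | .alethizor => if Term.alethizor = b then a else .alethizor
  | .enumerator => if Term.enumerator = b then a else .enumerator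
  | .noema n => if Term.noema n = b then a else .noema n
  | .joint c d => if Term.joint c d = b then a else .joint (Term.replace b a c) (Term.replace b a d)
  | .sort n A => if Term.sort n A = b then a else .sort n (A.replace b a)
/-- Replacement of every occurrence of the cognomen `b` by `a`, in a formula. -/
noncomputable def Formula.replace (b a : Term) : Formula → Formula
  | .app c d => .app (Term.replace b a c) (Term.replace b a d)
  | .nor A B => .nor (A.replace b a) (B.replace b a)
  | .all n A => .all n (A.replace b a)
end

mutual
/-- Alphabetological variants among propositions. -/
inductive PropVariant : Formula → Formula → Prop
  | congruent {A B : Formula} : A.IsProposition → B.IsProposition →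
      Provable (biimp A B) → PropVariant A B
  | replace {A B : Formula} {a b : Term} : B.IsProposition → TermVariant a b →
      PropVariant A (B.replace b a) → PropVariant A B
/-- Alphabetological variants among cognomina. -/
inductive TermVariant : Term → Term → Prop
  | alethizor : TermVariant .alethizor .alethizor
  | enumerator : TermVariant .enumerator .enumerator
  | joint {c d e f : Term} : TermVariant c e → TermVariant d f →
      TermVariant (.joint c d) (.joint e f)
  | joint_swap {c d e f : Term} : TermVariant c f → TermVariant d e →
      TermVariant (.joint c d) (.joint e f)
  | sort {x y : ℕ} {A B : Formula} : PropVariant (ex x A) (ex y B) →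
      TermVariant (.sort x A) (.sort y B)
end

/-- `c` is the smallest (as a number) among the cognomina that satisfy `p`. -/
def IsSmallestCognomen (p : Term → Prop) (c : Term) : Prop :=
  (c.IsCognomen ∧ p c) ∧ ∀ d : Term, d.IsCognomen → p d → c.num ≤ d.num

/-- The enumeration `e`: `Enum n b` if `b` is a cognomen and a variant `c` of `b` is the
smallest cognomen with which no `m < n` is paired. -/
def Enum (n : ℕ) (b : Term) : Prop :=
  b.IsCognomen ∧ ∃ c, TermVariant c b ∧
    IsSmallestCognomen (fun d => ¬ ∃ m, ∃ _ : m < n, Enum m d) c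
termination_by n

open Classical in
/-- The smallest cognomen with number `n` in the enumeration. -/
noncomputable def nthCognomen (n : ℕ) : Term :=
  if h : ∃ c, IsSmallestCognomen (fun d => ¬ ∃ m, m < n ∧ Enum m d) c then h.choose
  else .alethizor

/-! ## Semantics

In this section `ev` stands for the set of the propositions that, at an ordinal `α`, hold
from some ordinal below `α` on at all later ordinals below `α`. All that holds at `α` is
determined by `ev`. -/

/-- Identity of cognomina at an ordinal: membership in the same cognomina `{u | A}`.
Membership in the other cognomina respects this relation, so it agrees with `eq`. -/
def Ident (ev : Set Formula) (a b : Term) : Prop :=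
  ∀ (u : ℕ) (A : Formula), (Term.sort u A).IsCognomen →
    (A.subst a u ∈ ev ↔ A.subst b u ∈ ev)

open Classical in
/-- The cognomen that the noema `v_n` names at an ordinal: the `n`-th enumerated cognomen
if it is distinct there from what the earlier noemata name, and else what `v_(n-1)` names. -/
noncomputable def den (ev : Set Formula) : ℕ → Term
  | 0 => nthCognomen 0
  | n + 1 =>
    if ∃ m : Fin (n + 1), Ident ev (den ev m) (nthCognomen (n + 1)) then den ev n
    else nthCognomen (n + 1)
termination_by n => n
decreasing_by
  all_goals omega

/-- `Mem ev a b`: the cognomen `a` is a member of the cognomen `b` at an ordinal. -/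
def Mem (ev : Set Formula) (a : Term) : Term → Prop
  | .sort u A => A.subst a u ∈ ev
  | .joint b c => ¬ Mem ev a b ∧ ¬ Mem ev a c
  -- `a = ⌜A⌝` and `A` is true, for some formula `A`
  | .alethizor => ∃ A : Formula, Ident ev a (numeral A.num) ∧ A.inst (den ev) ∈ ev
  -- `a = ⟨⌜n⌝, b⟩` and `b = v_n`, for some term `b` and number `n`
  | .enumerator => ∃ (b : Term) (n : ℕ),
      Ident ev a ((opair (numeral n) b).inst (den ev)) ∧ Ident ev (b.inst (den ev)) (den ev n)
  -- not a cognomen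
  | .noema _ => False

def Formula.depth : Formula → ℕ
  | .app _ _ => 0
  | .nor A B => max A.depth B.depth + 1
  | .all _ A => A.depth + 1

theorem Formula.depth_inst : ∀ (A : Formula) (ρ : ℕ → Term), (A.inst ρ).depth = A.depth
  | .app _ _, _ => by simp [Formula.inst, Formula.depth]
  | .nor A B, ρ => by
      simp [Formula.inst, Formula.depth, Formula.depth_inst A ρ, Formula.depth_inst B ρ]
  | .all n A, ρ => by
      simp [Formula.inst, Formula.depth, Formula.depth_inst A _]

/-- The propositions that hold at an ordinal. -/
def Sat (ev : Set Formula) : Formula → Prop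
  | .app b a => Mem ev a b
  | .nor A B => ¬ Sat ev A ∧ ¬ Sat ev B
  | .all y A => ∀ a : Term, a.IsCognomen → Sat ev (A.subst a y)
termination_by A => A.depth
decreasing_by
  · simp only [Formula.depth]; omega
  · simp only [Formula.depth]; omega
  · simp only [Formula.depth, Formula.subst, Formula.depth_inst]; omega

/-- `Holds α A`: the formula `A` holds at the ordinal `α` in the semantic process. The noemata
present in `A` are names, and are replaced by the cognomina they name at `α`. -/
def Holds (α : Ordinal.{0}) (A : Formula) : Prop :=
  let ev : Set Formula := {B | ∃ β, β < α ∧ ∀ γ, ∀ _ : γ < α, β ≤ γ → Holds γ B}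
  Sat ev (A.inst (den ev))
termination_by α

/-- The formulas that are true at `γ`. -/
def trueAt (γ : Ordinal.{0}) : Set Formula := {A | Holds γ (truth A)}

def stablyIn : Set Formula := {A | ∃ β, ∀ γ, β ≤ γ → A ∈ trueAt γ}

def stablyOut : Set Formula := {A | ∃ β, ∀ γ, β ≤ γ → A ∉ trueAt γ}

def unstable : Set Formula := (stablyIn ∪ stablyOut)ᶜ

/-- The limit ordinal `κ` covers the semantic process. -/
def Covers (κ : Ordinal.{0}) : Prop :=
  Order.IsSuccLimit κ ∧
    ∀ γ, κ ≤ γ → stablyIn ⊆ trueAt γ ∧ trueAt γ ⊆ stablyIn ∪ unstable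

/-- The limit ordinal `σ` stabilizes the semantic process. -/
def Stabilizes (σ : Ordinal.{0}) : Prop := Covers σ ∧ trueAt σ ⊆ stablyIn

/-- The closure ordinal: the least stabilizing ordinal. -/
noncomputable def koppa : Ordinal.{0} := sInf {σ | Stabilizes σ}

/-- `A` is a maxim of `£`. -/
def Maxim (A : Formula) : Prop := Holds koppa (truth A)

end Librationism

/-!
The equivalence holds at every ordinal `α` in place of the closure ordinal, and it rests on the
fact that identity in the semantic process is coextensionality in the past: cognomina `a` and `b`
are identical at `α` iff they have the same members at every `γ < α` (`ident_iff_coext`).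

For the forward direction, the conditions `a = u` and `∀ x (x ∈ a ↔ x ∈ u)` on `u` are met by `a`
at all ordinals, so that they are met by `b` from some `β < α` on, and below `β` one argues by
induction. For the converse, if `a` and `b` are identical and coextensional at `γ`, then no formula
tells them apart at `γ` (`sat_inst_congr`): sorts are dealt with by identity, occurrences of `a` to
the right of `∈` by coextensionality. So no formula tells them apart below `α`, and they are
identical at `α`.

The members of `{x | x ∈ a}` at `γ` are the cognomina that are members of `a` at all ordinals from
some `β < γ` on. If `a` and `{x | x ∈ a}` agree at all `δ < γ`, then by induction `a` is empty at
all of these, and conversely. Since `∅` is always empty, `a = {x | x ∈ a}` holds at `γ` iff `a` is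
empty below `γ` iff `a = ∅` holds at `γ`.
-/

namespace Librationism

/-! ### Instantiation -/

mutual
/-- The indices of the noemata that some `{v_n | ·}` or `∀ v_n` in a term binds. -/
def Term.binders : Term → Finset ℕ
  | .alethizor => ∅
  | .enumerator => ∅
  | .noema _ => ∅
  | .joint a b => a.binders ∪ b.binders
  | .sort n A => insert n A.binders
/-- The indices of the noemata that some `{v_n | ·}` or `∀ v_n` in a formula binds. -/
def Formula.binders : Formula → Finset ℕ
  | .app b a => b.binders ∪ a.binders
  | .nor A B => A.binders ∪ B.binders
  | .all n A => insert n A.binders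
end

theorem update_congr_of_erase {s : Finset ℕ} {n : ℕ} {ρ τ : ℕ → Term}
    (h : ∀ m ∈ s.erase n, ρ m = τ m) (t : Term) :
    ∀ m ∈ s, Function.update ρ n t m = Function.update τ n t m := by
  intro m hm
  by_cases hmn : m = n
  · subst hmn; simp
  · simp [hmn, h m (Finset.mem_erase.2 ⟨hmn, hm⟩)]

mutual
theorem Term.inst_congr : ∀ (a : Term) {ρ τ : ℕ → Term},
    (∀ n ∈ a.noemata, ρ n = τ n) → a.inst ρ = a.inst τ
  | .alethizor, _, _, _ => rfl
  | .enumerator, _, _, _ => rfl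
  | .noema n, _, _, h => h n (by simp [Term.noemata])
  | .joint a b, _, _, h => by
      simp only [Term.noemata, Finset.mem_union] at h
      simp only [Term.inst, Term.inst_congr a fun n hn => h n (.inl hn),
        Term.inst_congr b fun n hn => h n (.inr hn)]
  | .sort n A, _, _, h => by
      simp only [Term.inst, Formula.inst_congr A (update_congr_of_erase h (.noema n))]
theorem Formula.inst_congr : ∀ (A : Formula) {ρ τ : ℕ → Term},
    (∀ n ∈ A.noemata, ρ n = τ n) → A.inst ρ = A.inst τ
  | .app b a, _, _, h => by
      simp only [Formula.noemata, Finset.mem_union] at h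
      simp only [Formula.inst, Term.inst_congr b fun n hn => h n (.inl hn),
        Term.inst_congr a fun n hn => h n (.inr hn)]
  | .nor A B, _, _, h => by
      simp only [Formula.noemata, Finset.mem_union] at h
      simp only [Formula.inst, Formula.inst_congr A fun n hn => h n (.inl hn),
        Formula.inst_congr B fun n hn => h n (.inr hn)]
  | .all n A, _, _, h => by
      simp only [Formula.inst, Formula.inst_congr A (update_congr_of_erase h (.noema n))]
end

mutual
theorem Term.inst_noema : ∀ a : Term, a.inst .noema = a
  | .alethizor => rfl
  | .enumerator => rfl
  | .noema _ => rfl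
  | .joint a b => by simp only [Term.inst, Term.inst_noema a, Term.inst_noema b]
  | .sort n A => by simp only [Term.inst, Function.update_eq_self, Formula.inst_noema A]
theorem Formula.inst_noema : ∀ A : Formula, A.inst .noema = A
  | .app b a => by simp only [Formula.inst, Term.inst_noema a, Term.inst_noema b]
  | .nor A B => by simp only [Formula.inst, Formula.inst_noema A, Formula.inst_noema B]
  | .all n A => by simp only [Formula.inst, Function.update_eq_self, Formula.inst_noema A]
end

theorem Term.IsCognomen.inst_eq {a : Term} (h : a.IsCognomen) (ρ : ℕ → Term) : a.inst ρ = a := by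
  rw [a.inst_congr (τ := .noema) (by simp [show a.noemata = ∅ from h]), a.inst_noema]

theorem Formula.IsProposition.inst_eq {A : Formula} (h : A.IsProposition) (ρ : ℕ → Term) :
    A.inst ρ = A := by
  rw [A.inst_congr (τ := .noema) (by simp [show A.noemata = ∅ from h]), A.inst_noema]

mutual
theorem Term.exists_of_mem_noemata_inst : ∀ (a : Term) {ρ : ℕ → Term} {z : ℕ},
    z ∈ (a.inst ρ).noemata → ∃ n ∈ a.noemata, z ∈ (ρ n).noemata
  | .alethizor, _, _, h => by simp [Term.inst, Term.noemata] at h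
  | .enumerator, _, _, h => by simp [Term.inst, Term.noemata] at h
  | .noema n, _, _, h => ⟨n, by simp [Term.noemata], h⟩
  | .joint a b, _, _, h => by
      simp only [Term.inst, Term.noemata, Finset.mem_union] at h ⊢
      rcases h with h | h
      · obtain ⟨n, hn, hz⟩ := Term.exists_of_mem_noemata_inst a h
        exact ⟨n, .inl hn, hz⟩
      · obtain ⟨n, hn, hz⟩ := Term.exists_of_mem_noemata_inst b h
        exact ⟨n, .inr hn, hz⟩
  | .sort y A, _, _, h => by
      simp only [Term.inst, Term.noemata, Finset.mem_erase] at h ⊢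
      obtain ⟨n, hn, hz⟩ := Formula.exists_of_mem_noemata_inst A h.2
      by_cases hny : n = y
      · subst hny; simp [Term.noemata, h.1] at hz
      · exact ⟨n, ⟨hny, hn⟩, by simpa [hny] using hz⟩
theorem Formula.exists_of_mem_noemata_inst : ∀ (A : Formula) {ρ : ℕ → Term} {z : ℕ},
    z ∈ (A.inst ρ).noemata → ∃ n ∈ A.noemata, z ∈ (ρ n).noemata
  | .app b a, _, _, h => by
      simp only [Formula.inst, Formula.noemata, Finset.mem_union] at h ⊢
      rcases h with h | h
      · obtain ⟨n, hn, hz⟩ := Term.exists_of_mem_noemata_inst b h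
        exact ⟨n, .inl hn, hz⟩
      · obtain ⟨n, hn, hz⟩ := Term.exists_of_mem_noemata_inst a h
        exact ⟨n, .inr hn, hz⟩
  | .nor A B, _, _, h => by
      simp only [Formula.inst, Formula.noemata, Finset.mem_union] at h ⊢
      rcases h with h | h
      · obtain ⟨n, hn, hz⟩ := Formula.exists_of_mem_noemata_inst A h
        exact ⟨n, .inl hn, hz⟩
      · obtain ⟨n, hn, hz⟩ := Formula.exists_of_mem_noemata_inst B h
        exact ⟨n, .inr hn, hz⟩
  | .all y A, _, _, h => by
      simp only [Formula.inst, Formula.noemata, Finset.mem_erase] at h ⊢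
      obtain ⟨n, hn, hz⟩ := Formula.exists_of_mem_noemata_inst A h.2
      by_cases hny : n = y
      · subst hny; simp [Term.noemata, h.1] at hz
      · exact ⟨n, ⟨hny, hn⟩, by simpa [hny] using hz⟩
end

theorem Term.isCognomen_inst {a : Term} {ρ : ℕ → Term}
    (h : ∀ n ∈ a.noemata, (ρ n).IsCognomen) : (a.inst ρ).IsCognomen := by
  refine Finset.eq_empty_of_forall_notMem fun z hz => ?_
  obtain ⟨n, hn, hz⟩ := a.exists_of_mem_noemata_inst hz
  simp [show (ρ n).noemata = ∅ from h n hn] at hz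

theorem Formula.isProposition_inst {A : Formula} {ρ : ℕ → Term}
    (h : ∀ n ∈ A.noemata, (ρ n).IsCognomen) : (A.inst ρ).IsProposition := by
  refine Finset.eq_empty_of_forall_notMem fun z hz => ?_
  obtain ⟨n, hn, hz⟩ := A.exists_of_mem_noemata_inst hz
  simp [show (ρ n).noemata = ∅ from h n hn] at hz

/-- Freedom from capture is inherited by the instantiation that is used below a binder. -/
theorem captureFree_update {s : Finset ℕ} {τ : ℕ → Term} {y : ℕ}
    (h : ∀ z ∈ insert y s, ∀ n, n ≠ z → z ∉ (τ n).noemata) :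
    ∀ z ∈ s, ∀ n, n ≠ z → z ∉ (Function.update τ y (.noema y) n).noemata := by
  intro z hz n hn
  by_cases hny : n = y
  · subst hny; simpa [Term.noemata] using hn.symm
  · simpa [hny] using h z (Finset.mem_insert_of_mem hz) n hn

theorem inst_update_eq {τ ρ : ℕ → Term} {y : ℕ} (h : ∀ n, n ≠ y → y ∉ (τ n).noemata) :
    (fun n => (Function.update τ y (.noema y) n).inst (Function.update ρ y (.noema y))) =
      Function.update (fun n => (τ n).inst ρ) y (.noema y) := by
  funext n
  by_cases hny : n = y
  · subst hny; simp [Term.inst]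
  · simp only [Function.update_of_ne hny]
    refine Term.inst_congr _ fun m hm => Function.update_of_ne ?_ _ _
    rintro rfl
    exact h n hny hm

mutual
/-- Instantiations compose if the first one puts no noema in the scope of a binder of it. -/
theorem Term.inst_inst : ∀ (a : Term) (τ ρ : ℕ → Term),
    (∀ z ∈ a.binders, ∀ n, n ≠ z → z ∉ (τ n).noemata) →
      (a.inst τ).inst ρ = a.inst fun n => (τ n).inst ρ
  | .alethizor, _, _, _ => rfl
  | .enumerator, _, _, _ => rfl
  | .noema _, _, _, _ => rfl
  | .joint a b, τ, ρ, h => by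
      simp only [Term.binders, Finset.mem_union] at h
      simp only [Term.inst, Term.inst_inst a τ ρ fun z hz => h z (.inl hz),
        Term.inst_inst b τ ρ fun z hz => h z (.inr hz)]
  | .sort y A, τ, ρ, h => by
      rw [Term.binders] at h
      simp only [Term.inst, Formula.inst_inst A _ _ (captureFree_update h),
        inst_update_eq (h y (Finset.mem_insert_self _ _))]
/-- Instantiations compose if the first one puts no noema in the scope of a binder of it. -/
theorem Formula.inst_inst : ∀ (A : Formula) (τ ρ : ℕ → Term),
    (∀ z ∈ A.binders, ∀ n, n ≠ z → z ∉ (τ n).noemata) →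
      (A.inst τ).inst ρ = A.inst fun n => (τ n).inst ρ
  | .app b a, τ, ρ, h => by
      simp only [Formula.binders, Finset.mem_union] at h
      simp only [Formula.inst, Term.inst_inst b τ ρ fun z hz => h z (.inl hz),
        Term.inst_inst a τ ρ fun z hz => h z (.inr hz)]
  | .nor A B, τ, ρ, h => by
      simp only [Formula.binders, Finset.mem_union] at h
      simp only [Formula.inst, Formula.inst_inst A τ ρ fun z hz => h z (.inl hz),
        Formula.inst_inst B τ ρ fun z hz => h z (.inr hz)]
  | .all y A, τ, ρ, h => by
      rw [Formula.binders] at h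
      simp only [Formula.inst, Formula.inst_inst A _ _ (captureFree_update h),
        inst_update_eq (h y (Finset.mem_insert_self _ _))]
end

/-- To instantiate all noemata but `v_y` by cognomina and then to substitute `c` for `v_y` is to
instantiate once. -/
theorem Formula.subst_inst_update (A : Formula) {ρ : ℕ → Term} (y : ℕ) (c : Term)
    (hρ : ∀ n, n ≠ y → (ρ n).IsCognomen) :
    (A.inst (Function.update ρ y (.noema y))).subst c y = A.inst (Function.update ρ y c) := by
  rw [Formula.subst, Formula.inst_inst]
  · congr 1
    funext n
    by_cases hny : n = y
    · subst hny; simp [Term.inst]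
    · simp only [Function.update_of_ne hny, (hρ n hny).inst_eq]
  · intro z _ n hn
    by_cases hny : n = y
    · subst hny; simpa [Term.noemata] using hn.symm
    · simp [hny, show (ρ n).noemata = ∅ from hρ n hny]

theorem Term.IsCognomen.eq_of_mem_noemata {u : ℕ} {A : Formula}
    (hA : (Term.sort u A).IsCognomen) :
    ∀ n ∈ A.noemata, n = u := by
  intro n hn
  by_contra hnu
  have : n ∈ A.noemata.erase u := Finset.mem_erase.2 ⟨hnu, hn⟩
  rw [show A.noemata.erase u = ∅ from hA] at this
  simp at this

/-! ### Identity and truth in terms of satisfaction -/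

theorem fresh_notMem (s : Finset ℕ) : fresh s ∉ s :=
  Nat.sInf_mem (s := {n | n ∉ s}) (Infinite.exists_notMem_finset s)

theorem noemata_eq (a b : Term) : (eq a b).noemata = a.noemata ∪ b.noemata := by
  have h := fresh_notMem (a.noemata ∪ b.noemata)
  rw [eq]
  generalize fresh (a.noemata ∪ b.noemata) = u at h
  ext z
  simp only [Finset.mem_union] at h
  simp only [imp, mem, Formula.noemata, Term.noemata, Finset.mem_erase, Finset.mem_union,
    Finset.mem_singleton]
  constructor
  · tauto
  · intro hz
    refine ⟨?_, by tauto⟩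
    rintro rfl
    exact h hz

theorem isCognomen_emptySort (y : ℕ) : (emptySort y).IsCognomen := by
  simp [Term.IsCognomen, emptySort, neg, Term.noemata, Formula.noemata, noemata_eq]

section Sat

variable {ev : Set Formula}

theorem sat_neg {A : Formula} : Sat ev (neg A) ↔ ¬ Sat ev A := by
  simp only [neg, Sat]; tauto

theorem sat_all {y : ℕ} {A : Formula} :
    Sat ev (.all y A) ↔ ∀ c : Term, c.IsCognomen → Sat ev (A.subst c y) := by
  rw [Sat]

theorem Ident.refl (a : Term) : Ident ev a a := fun _ _ _ => Iff.rfl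

theorem Ident.symm {a b : Term} (h : Ident ev a b) : Ident ev b a :=
  fun u A hA => (h u A hA).symm

theorem Ident.trans {a b c : Term} (h : Ident ev a b) (h' : Ident ev b c) : Ident ev a c :=
  fun u A hA => (h u A hA).trans (h' u A hA)

theorem Ident.congr_left {a b c : Term} (h : Ident ev a b) : Ident ev a c ↔ Ident ev b c :=
  ⟨h.symm.trans, h.trans⟩

theorem Ident.mem_congr {a b : Term} (h : Ident ev a b) :
    ∀ c : Term, c.IsCognomen → (Mem ev a c ↔ Mem ev b c)
  | .alethizor, _ => by simp only [Mem, h.congr_left]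
  | .enumerator, _ => by simp only [Mem, h.congr_left]
  | .noema _, _ => by simp only [Mem]
  | .joint c d, hcd => by
      obtain ⟨hc, hd⟩ := Finset.union_eq_empty.1 hcd
      simp only [Mem, h.mem_congr c hc, h.mem_congr d hd]
  | .sort u A, hA => by simpa only [Mem] using h u A hA

/-- Leibnizian identity is `Ident`. One half of the biconditionals in `Ident` comes from membership
in the complement `↓bb` of a sort `b`. -/
theorem forall_mem_imp_iff_ident {a b : Term} :
    (∀ c : Term, c.IsCognomen → Mem ev a c → Mem ev b c) ↔ Ident ev a b := by
  refine ⟨fun h u A hA => ⟨fun ha => ?_, fun hb => ?_⟩, fun h c hc => (h.mem_congr c hc).1⟩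
  · simpa only [Mem] using h _ hA (by simpa only [Mem] using ha)
  · by_contra ha
    have := h (.joint (.sort u A) (.sort u A))
      (by simpa only [Term.IsCognomen, Term.noemata, Finset.union_idempotent] using hA)
    simp only [Mem] at this
    exact (this ⟨ha, ha⟩).1 hb

theorem sat_eq_inst {a b : Term} {ρ : ℕ → Term}
    (ha : (a.inst ρ).IsCognomen) (hb : (b.inst ρ).IsCognomen) :
    Sat ev ((eq a b).inst ρ) ↔ Ident ev (a.inst ρ) (b.inst ρ) := by
  have h := fresh_notMem (a.noemata ∪ b.noemata)
  rw [eq]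
  generalize fresh (a.noemata ∪ b.noemata) = u at h
  simp only [Finset.mem_union, not_or] at h
  have key : ∀ t : Term, u ∉ t.noemata → ∀ s, t.inst (Function.update ρ u s) = t.inst ρ := by
    intro t ht s
    exact t.inst_congr fun n hn => Function.update_of_ne (ne_of_mem_of_not_mem hn ht) _ _
  simp only [imp, mem, Formula.inst, sat_all, Formula.subst, Term.inst, key _ h.1, key _ h.2,
    Function.update_self, ha.inst_eq, hb.inst_eq]
  rw [← forall_mem_imp_iff_ident]
  simp only [Sat]
  refine forall_congr' fun c => imp_congr_right fun _ => ?_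
  tauto

theorem sat_truth_inst {A : Formula} {ρ : ℕ → Term} (hA : (A.inst ρ).IsProposition) :
    Sat ev ((truth A).inst ρ) ↔ A.inst ρ ∈ ev := by
  have h := fresh_notMem A.noemata
  rw [truth]
  generalize fresh A.noemata = y at h
  have key : A.inst (Function.update ρ y (.noema y)) = A.inst ρ := by
    exact A.inst_congr fun n hn => Function.update_of_ne (ne_of_mem_of_not_mem hn h) _ _
  simp only [ex, neg, mem, Formula.inst, Term.inst, Function.update_self, Function.update_idem,
    key, Sat, Formula.subst, hA.inst_eq, Mem]
  simp only [and_self, not_forall, not_not]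
  exact ⟨fun ⟨_, _, h⟩ => h, fun h => ⟨.alethizor, rfl, h⟩⟩

/-! ### Identical coextensional cognomina are indiscernible -/

/-- Coextensionality of cognomina at an ordinal. -/
def Coext (ev : Set Formula) (a b : Term) : Prop :=
  ∀ c : Term, c.IsCognomen → (Mem ev c a ↔ Mem ev c b)

theorem isCognomen_update {σ : ℕ → Term} (hσ : ∀ n, (σ n).IsCognomen) {a : Term}
    (ha : a.IsCognomen) (u n : ℕ) : (Function.update σ u a n).IsCognomen := by
  by_cases hn : n = u
  · subst hn; simpa using ha
  · simpa [hn] using hσ n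

theorem isCognomen_sort_inst (A : Formula) {σ : ℕ → Term} (hσ : ∀ n, (σ n).IsCognomen) (u : ℕ) :
    (Term.sort u (A.inst (Function.update σ u (.noema u)))).IsCognomen := by
  refine Finset.eq_empty_of_forall_notMem fun z hz => ?_
  obtain ⟨hzu, hz⟩ := Finset.mem_erase.1 hz
  obtain ⟨n, -, hz⟩ := A.exists_of_mem_noemata_inst hz
  by_cases hn : n = u
  · subst hn; simp [Term.noemata, hzu] at hz
  · simp [hn, show (σ n).noemata = ∅ from hσ n] at hz

theorem Ident.inst_mem_iff {a b : Term} (h : Ident ev a b) (A : Formula) {σ : ℕ → Term}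
    (hσ : ∀ n, (σ n).IsCognomen) (u : ℕ) :
    A.inst (Function.update σ u a) ∈ ev ↔ A.inst (Function.update σ u b) ∈ ev := by
  have := h u _ (isCognomen_sort_inst A hσ u)
  rwa [A.subst_inst_update u a fun n _ => hσ n, A.subst_inst_update u b fun n _ => hσ n] at this

/-- Identity is a congruence for the formation of terms. -/
theorem Ident.inst {a b : Term} (h : Ident ev a b) (t : Term) {σ : ℕ → Term}
    (hσ : ∀ n, (σ n).IsCognomen) (u : ℕ) :
    Ident ev (t.inst (Function.update σ u a)) (t.inst (Function.update σ u b)) := by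
  intro v C hC
  -- A noema `v_w` that takes the place of `v_u` and is not captured by the binders of `t` and `C`.
  obtain ⟨w, hw⟩ := Infinite.exists_notMem_finset (t.noemata ∪ t.binders ∪ C.binders)
  simp only [Finset.mem_union, not_or] at hw
  obtain ⟨⟨hwt, hwb⟩, hwC⟩ := hw
  set t' : Term := t.inst (Function.update σ u (.noema w)) with ht'
  have ht'_noemata : ∀ z ∈ t'.noemata, z = w := by
    intro z hz
    obtain ⟨n, -, hz⟩ := t.exists_of_mem_noemata_inst hz
    by_cases hn : n = u
    · subst hn; simpa [Term.noemata] using hz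
    · simp [hn, show (σ n).noemata = ∅ from hσ n] at hz
  have ht'_inst : ∀ d, t'.inst (Function.update .noema w d) = t.inst (Function.update σ u d) := by
    intro d
    rw [ht', Term.inst_inst]
    · congr 1
      funext n
      by_cases hn : n = u
      · subst hn; simp [Term.inst]
      · simp only [Function.update_of_ne hn, (hσ n).inst_eq]
    · intro z hz n _ hz'
      by_cases hn : n = u
      · subst hn
        simp only [Function.update_self, Term.noemata, Finset.mem_singleton] at hz'
        exact hwb (hz' ▸ hz)
      · simp [hn, show (σ n).noemata = ∅ from hσ n] at hz'
  have hCv := hC.eq_of_mem_noemata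
  have hD_subst : ∀ d, (C.subst t' v).subst d w = C.subst (t.inst (Function.update σ u d)) v := by
    intro d
    rw [Formula.subst, Formula.subst, Formula.inst_inst]
    · refine C.inst_congr fun n hn => ?_
      rw [hCv n hn, Function.update_self, ht'_inst, Function.update_self]
    · intro z hz n hn hz'
      by_cases hnv : n = v
      · subst hnv
        rw [Function.update_self] at hz'
        exact hwC (ht'_noemata z hz' ▸ hz)
      · simp only [Function.update_of_ne hnv, Term.noemata, Finset.mem_singleton] at hz'
        exact hn hz'.symm
  have hD : (Term.sort w (C.subst t' v)).IsCognomen := by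
    refine Finset.eq_empty_of_forall_notMem fun z hz => ?_
    obtain ⟨hzw, hz⟩ := Finset.mem_erase.1 hz
    obtain ⟨n, hn, hz⟩ := C.exists_of_mem_noemata_inst hz
    rw [hCv n hn, Function.update_self] at hz
    exact hzw (ht'_noemata z hz)
  simpa only [hD_subst] using h w _ hD

theorem mem_inst_congr {a b c : Term} (ha : a.IsCognomen) (hb : b.IsCognomen) (h : Ident ev a b)
    (h' : Coext ev a b) (hc : c.IsCognomen) {σ : ℕ → Term} (hσ : ∀ n, (σ n).IsCognomen) (u : ℕ) :
    ∀ s : Term, Mem ev c (s.inst (Function.update σ u a)) ↔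
      Mem ev c (s.inst (Function.update σ u b))
  | .alethizor => Iff.rfl
  | .enumerator => Iff.rfl
  | .noema n => by
      by_cases hn : n = u
      · subst hn; simpa [Term.inst] using h' c hc
      · simp [Term.inst, hn]
  | .joint s t => by
      simp only [Term.inst, Mem, mem_inst_congr ha hb h h' hc hσ u s,
        mem_inst_congr ha hb h h' hc hσ u t]
  | .sort v C => by
      by_cases hvu : v = u
      · subst hvu; simp only [Term.inst, Function.update_idem]
      · have key (d : Term) (hd : d.IsCognomen) :
            (C.inst (Function.update (Function.update σ u d) v (.noema v))).subst c v =
              C.inst (Function.update (Function.update σ v c) u d) := by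
          rw [C.subst_inst_update v c fun n _ => isCognomen_update hσ hd u n,
            Function.update_comm hvu]
        simp only [Term.inst, Mem, key a ha, key b hb]
        exact h.inst_mem_iff C (isCognomen_update hσ hc v) u

theorem sat_inst_congr {a b : Term} (ha : a.IsCognomen) (hb : b.IsCognomen) (h : Ident ev a b)
    (h' : Coext ev a b) (u : ℕ) : ∀ (A : Formula) {σ : ℕ → Term}, (∀ n, (σ n).IsCognomen) →
      (Sat ev (A.inst (Function.update σ u a)) ↔ Sat ev (A.inst (Function.update σ u b)))
  | .app s t, σ, hσ => by
      simp only [Formula.inst, Sat]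
      rw [(h.inst t hσ u).mem_congr _ (Term.isCognomen_inst fun n _ => isCognomen_update hσ ha u n)]
      exact mem_inst_congr ha hb h h'
        (Term.isCognomen_inst fun n _ => isCognomen_update hσ hb u n) hσ u s
  | .nor A B, σ, hσ => by
      simp only [Formula.inst, Sat, sat_inst_congr ha hb h h' u A hσ,
        sat_inst_congr ha hb h h' u B hσ]
  | .all y A, σ, hσ => by
      by_cases hyu : y = u
      · subst hyu; simp only [Formula.inst, Function.update_idem]
      · simp only [Formula.inst, sat_all]
        refine forall_congr' fun c => imp_congr_right fun hc => ?_
        rw [A.subst_inst_update y c fun n _ => isCognomen_update hσ ha u n,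
          A.subst_inst_update y c fun n _ => isCognomen_update hσ hb u n,
          ← Function.update_comm hyu, ← Function.update_comm hyu]
        exact sat_inst_congr ha hb h h' u A (isCognomen_update hσ hc y)

end Sat

/-! ### The semantic process -/

theorem isCognomen_nthCognomen (n : ℕ) : (nthCognomen n).IsCognomen := by
  unfold nthCognomen
  split_ifs with h
  · exact h.choose_spec.1.1
  · rfl

theorem isCognomen_den (ev : Set Formula) : ∀ n, (den ev n).IsCognomen
  | 0 => by rw [den]; exact isCognomen_nthCognomen 0
  | n + 1 => by
      rw [den]
      split_ifs
      · exact isCognomen_den ev n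
      · exact isCognomen_nthCognomen (n + 1)

/-- The set of the formulas that hold at all ordinals from some ordinal below `α` on and
below `α`. -/
def evAt (α : Ordinal.{0}) : Set Formula :=
  {B | ∃ β, β < α ∧ ∀ γ, γ < α → β ≤ γ → Holds γ B}

theorem holds_iff_sat_inst {α : Ordinal.{0}} {A : Formula} :
    Holds α A ↔ Sat (evAt α) (A.inst (den (evAt α))) := by
  rw [Holds]; rfl

theorem Formula.IsProposition.holds_iff {α : Ordinal.{0}} {A : Formula} (hA : A.IsProposition) :
    Holds α A ↔ Sat (evAt α) A := by
  rw [holds_iff_sat_inst, hA.inst_eq]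

theorem Formula.IsProposition.mem_evAt {α : Ordinal.{0}} {A : Formula} (hA : A.IsProposition) :
    A ∈ evAt α ↔ ∃ β < α, ∀ γ < α, β ≤ γ → Sat (evAt γ) A := by
  simp only [evAt, Set.mem_ofPred_eq, hA.holds_iff]

theorem isProposition_subst {u : ℕ} {A : Formula} (hA : (Term.sort u A).IsCognomen) {a : Term}
    (ha : a.IsCognomen) : (A.subst a u).IsProposition :=
  Formula.isProposition_inst fun n hn => by
    rw [hA.eq_of_mem_noemata n hn, Function.update_self]; exact ha

/-- What `a` satisfies at all ordinals below `α`, every cognomen identical to `a` at `α` satisfies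
from some ordinal below `α` on. -/
theorem Ident.exists_forall_sat {α : Ordinal.{0}} {a b : Term} (h : Ident (evAt α) a b)
    (ha : a.IsCognomen) (hb : b.IsCognomen) (hα : 0 < α) {u : ℕ} {A : Formula}
    (hA : (Term.sort u A).IsCognomen) (hsat : ∀ γ < α, Sat (evAt γ) (A.subst a u)) :
    ∃ β < α, ∀ γ < α, β ≤ γ → Sat (evAt γ) (A.subst b u) :=
  (isProposition_subst hA hb).mem_evAt.1 <| (h u A hA).1 <|
    (isProposition_subst hA ha).mem_evAt.2 ⟨0, hα, fun γ hγ _ => hsat γ hγ⟩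

/-- Past identity: apply `Ident.exists_forall_sat` to the formula `a = v₀`. -/
theorem Ident.of_lt {a b : Term} (ha : a.IsCognomen) (hb : b.IsCognomen) (α : Ordinal.{0}) :
    Ident (evAt α) a b → ∀ γ < α, Ident (evAt γ) a b := by
  induction α using WellFoundedLT.induction with
  | ind α ih =>
  intro h γ hγ
  have hsub (γ : Ordinal.{0}) (d : Term) (hd : d.IsCognomen) :
      Sat (evAt γ) ((eq a (.noema 0)).subst d 0) ↔ Ident (evAt γ) a d := by
    rw [Formula.subst, sat_eq_inst] <;> simp [ha.inst_eq, Term.inst, ha, hd]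
  obtain ⟨β, hβ, hβγ⟩ := h.exists_forall_sat ha hb (pos_of_gt hγ) (u := 0)
    (A := eq a (.noema 0))
    (by simp [Term.IsCognomen, Term.noemata, noemata_eq, show a.noemata = ∅ from ha])
    fun γ _ => (hsub γ a ha).2 (.refl a)
  rcases le_or_gt β γ with hle | hlt
  · exact (hsub γ b hb).1 (hβγ γ hγ hle)
  · exact ih β hβ ((hsub β b hb).1 (hβγ β hβ le_rfl)) γ hlt

/-- Past coextensionality: apply `Ident.exists_forall_sat` to the formula
`∀ v₁ (v₁ ∈ a ↔ v₁ ∈ v₀)`. -/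
theorem Ident.coext_of_lt {a b : Term} (ha : a.IsCognomen) (hb : b.IsCognomen) (α : Ordinal.{0}) :
    Ident (evAt α) a b → ∀ γ < α, Coext (evAt γ) a b := by
  induction α using WellFoundedLT.induction with
  | ind α ih =>
  intro h γ hγ
  have hsub (γ : Ordinal.{0}) (d : Term) (hd : d.IsCognomen) :
      Sat (evAt γ) (Formula.subst d 0
        (.all 1 (biimp (mem (.noema 1) a) (mem (.noema 1) (.noema 0))))) ↔
        Coext (evAt γ) a d := by
    simp only [Formula.subst, biimp, conj, imp, mem, Formula.inst, Term.inst, sat_all,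
      ha.inst_eq, hd.inst_eq, Function.update_self, ne_eq, zero_ne_one, not_false_eq_true,
      Function.update_of_ne]
    refine forall_congr' fun c => imp_congr_right fun _ => ?_
    simp only [Sat]
    tauto
  obtain ⟨β, hβ, hβγ⟩ := h.exists_forall_sat ha hb (pos_of_gt hγ) (u := 0)
    (A := .all 1 (biimp (mem (.noema 1) a) (mem (.noema 1) (.noema 0))))
    (by
      simp only [Term.IsCognomen, biimp, conj, imp, mem, Term.noemata, Formula.noemata,
        show a.noemata = ∅ from ha]
      decide)
    fun γ _ => (hsub γ a ha).2 fun _ _ => Iff.rfl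
  rcases le_or_gt β γ with hle | hlt
  · exact (hsub γ b hb).1 (hβγ γ hγ hle)
  · exact ih β hβ (h.of_lt ha hb α β hβ) γ hlt

/-- Cognomina are identical at `α` iff they are coextensional at all earlier ordinals. -/
theorem ident_iff_coext {a b : Term} (ha : a.IsCognomen) (hb : b.IsCognomen) (α : Ordinal.{0}) :
    Ident (evAt α) a b ↔ ∀ γ < α, Coext (evAt γ) a b := by
  refine ⟨Ident.coext_of_lt ha hb α, ?_⟩
  induction α using WellFoundedLT.induction with
  | ind α ih =>
  intro h u A hA
  rw [(isProposition_subst hA ha).mem_evAt, (isProposition_subst hA hb).mem_evAt]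
  refine exists_congr fun β => and_congr_right fun _ => forall_congr' fun γ =>
    forall_congr' fun hγ => imp_congr_right fun _ => ?_
  -- The values of the instantiation away from `v_u` do not matter, but have to be cognomina.
  have key (d : Term) : A.subst d u = A.inst (Function.update (fun _ => .alethizor) u d) :=
    A.inst_congr fun n hn => by
      rw [hA.eq_of_mem_noemata n hn, Function.update_self, Function.update_self]
  rw [key, key]
  exact sat_inst_congr ha hb (ih γ hγ fun δ hδ => h δ (hδ.trans hγ)) (h γ hγ) u A fun _ => rfl

/-! ### Self-comprehension and emptiness -/

theorem not_mem_emptySort {α : Ordinal.{0}} {c : Term} (hc : c.IsCognomen) (y : ℕ) :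
    ¬ Mem (evAt α) c (emptySort y) := by
  have hprop := isProposition_subst (isCognomen_emptySort y) hc
  rw [emptySort, Mem, hprop.mem_evAt]
  rintro ⟨β, hβ, h⟩
  have := h β hβ le_rfl
  rw [Formula.subst, neg, Formula.inst, ← neg, sat_neg, sat_eq_inst] at this
  · exact this (.refl _)
  all_goals simpa [Term.inst] using hc

theorem isCognomen_sort_mem {a : Term} (ha : a.IsCognomen) (x : ℕ) :
    (Term.sort x (mem (.noema x) a)).IsCognomen := by
  simp [Term.IsCognomen, mem, Term.noemata, Formula.noemata, show a.noemata = ∅ from ha]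

theorem mem_sort_mem_iff {α : Ordinal.{0}} {a c : Term} (ha : a.IsCognomen) (hc : c.IsCognomen)
    (x : ℕ) : Mem (evAt α) c (.sort x (mem (.noema x) a)) ↔
      ∃ β < α, ∀ γ < α, β ≤ γ → Mem (evAt γ) c a := by
  rw [Mem, (isProposition_subst (isCognomen_sort_mem ha x) hc).mem_evAt]
  simp only [Formula.subst, mem, Formula.inst, Term.inst, Function.update_self, ha.inst_eq, Sat]

theorem ident_emptySort_iff {a : Term} (ha : a.IsCognomen) (y : ℕ) (α : Ordinal.{0}) :
    Ident (evAt α) a (emptySort y) ↔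
      ∀ γ < α, ∀ c : Term, c.IsCognomen → ¬ Mem (evAt γ) c a := by
  rw [ident_iff_coext ha (isCognomen_emptySort y)]
  refine forall₂_congr fun γ _ => forall₂_congr fun c hc => ?_
  simp only [not_mem_emptySort hc y, iff_false]

theorem ident_sort_mem_iff {a : Term} (ha : a.IsCognomen) (x : ℕ) (α : Ordinal.{0}) :
    Ident (evAt α) a (.sort x (mem (.noema x) a)) ↔
      ∀ γ < α, ∀ c : Term, c.IsCognomen → ¬ Mem (evAt γ) c a := by
  rw [ident_iff_coext ha (isCognomen_sort_mem ha x)]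
  constructor
  · intro h γ
    induction γ using WellFoundedLT.induction with
    | ind γ ih =>
    intro hγ c hc hmem
    obtain ⟨β, hβ, hmem⟩ := (mem_sort_mem_iff ha hc x).1 ((h γ hγ c hc).1 hmem)
    exact ih β hβ (hβ.trans hγ) c hc (hmem β hβ le_rfl)
  · intro h γ hγ c hc
    rw [mem_sort_mem_iff ha hc x]
    refine ⟨fun hmem => (h γ hγ c hc hmem).elim, ?_⟩
    rintro ⟨β, hβ, hmem⟩
    exact (h β (hβ.trans hγ) c hc (hmem β hβ le_rfl)).elim

theorem holds_truth_eq_iff {α : Ordinal.{0}} {a b : Term} :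
    Holds α (truth (eq a b)) ↔ ∃ β < α, ∀ γ < α, β ≤ γ →
      Ident (evAt γ) (a.inst (den (evAt α))) (b.inst (den (evAt α))) := by
  have hprop : ((eq a b).inst (den (evAt α))).IsProposition :=
    Formula.isProposition_inst fun n _ => isCognomen_den _ n
  rw [holds_iff_sat_inst, sat_truth_inst hprop, hprop.mem_evAt]
  simp only [sat_eq_inst (Term.isCognomen_inst fun n _ => isCognomen_den _ n)
    (Term.isCognomen_inst fun n _ => isCognomen_den _ n)]

/-- The equivalence at an arbitrary ordinal. -/
theorem holds_truth_eq_sort_mem_iff (α : Ordinal.{0}) {a : Term} {x : ℕ} (hx : x ∉ a.noemata)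
    (y : ℕ) : Holds α (truth (eq a (.sort x (mem (.noema x) a)))) ↔
      Holds α (truth (eq a (emptySort y))) := by
  have ha : (a.inst (den (evAt α))).IsCognomen :=
    Term.isCognomen_inst fun n _ => isCognomen_den _ n
  have hsort : (Term.sort x (mem (.noema x) a)).inst (den (evAt α)) =
      .sort x (mem (.noema x) (a.inst (den (evAt α)))) := by
    simp only [Term.inst, mem, Formula.inst, Function.update_self]
    rw [a.inst_congr fun n hn => Function.update_of_ne (ne_of_mem_of_not_mem hn hx) _ _]
  rw [holds_truth_eq_iff, holds_truth_eq_iff, hsort, (isCognomen_emptySort y).inst_eq]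
  simp only [ident_sort_mem_iff ha, ident_emptySort_iff ha]

end Librationism

theorem mainTheorem7 (a : Librationism.Term) (x y : ℕ) (hx : x ∉ a.noemata) :
    Librationism.Maxim
        (Librationism.eq a (.sort x (Librationism.mem (.noema x) a))) ↔
      Librationism.Maxim (Librationism.eq a (Librationism.emptySort y)) :=
  Librationism.holds_truth_eq_sort_mem_iff _ hx y
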